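/- Let $X$ be a compact metric space with its Borel $\sigma$-algebra, let $T:X\to X$ be continuous, and let $\mathcal M_{\rm inv}$ be the set of $T$-invariant Borel probability measures on $X$. For $\mu\in\mathcal M_{\rm inv}$ let $h_\mu\in[0,\infty]$ be its measure-theoretic (Kolmogorov--Sinai) entropy and let $$G_\mu=\Big\{x\in X:\ \tfrac1n\sum_{j=0}^{n-1}\delta_{T^jx}\to\mu\ \text{ in the weak-}*\text{ topology}\Big\}.$$ For $Z\subset X$ let $h_{\rm top}(Z)\in[0,\infty]$ be Bowen's topological entropy. It is defined as follows. Put $B_n(x,\epsilon)=\{y:\ d(T^jx,T^jy)<\epsilon \text{ for } 0\le j<n\}$ for $n\ge1$ and $\epsilon>0$. For $s\ge0$ let $H^s_N(Z,\epsilon)=\inf\sum_i e^{-sn_i}$, the infimum over all at most countable covers $\{B_{n_i}(x_i,\epsilon)\}_i$ of $Z$ with $n_i\ge N$ for all $i$, and put $H^s(Z,\epsilon)=\lim_{N\to\infty}H^s_N(Z,\epsilon)$. Then $h_{\rm top}(Z,\epsilon)=\inf\{s\ge0: H^s(Z,\epsilon)=0\}$ (with $\inf\emptyset=\infty$) and $h_{\rm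 top}(Z)=\lim_{\epsilon\to0}h_{\rm top}(Z,\epsilon)$; in particular $h_{\rm top}(\emptyset)=0$. Suppose that $(X,T)$ is saturated, that is, $h_{\rm top}(G_\mu)=h_\mu$ for every $\mu\in\mathcal M_{\rm inv}$. Let $I$ be a finite or countably infinite index set, let $\{\Phi_i\}_{i\in I}$ be a family of continuous functions $X\to\mathbb R$ with $\sup_{i\in I}\sup_{x\in X}|\Phi_i(x)|<\infty$, and let $\mathbf a=(a_i)_{i\in I}$ and $\mathbf b=(b_i)_{i\in I}$ be families of real numbers. Write $A_n\Phi_i(x)=\frac1n\sum_{j=0}^{n-1}\Phi_i(T^jx)$ and $$S(\mathbf a,\mathbf b)=\Big\{x\in X:\ a_i\le\liminf_{n\to\infty}A_n\Phi_i(x)\le\limsup_{n\to\infty}A_n\Phi_i(x)\le b_i\ \text{ for all } i\in I\Big\},$$ $$\mathcal M(\mathbf a,\mathbf b)=\Big\{\mu\in\mathcal M_{\rm inv}:\ a_i\le\int\Phi_i\,d\mu\le b_i\ \text{ for all } i\in I\Big\}.$$ Then $$h_{\rm top}\big(S(\mathbf a,\mathbf b)\big)=\sup_{\mu\in\mathcal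 M(\mathbf a,\mathbf b)}h_\mu ,$$ where the supremum of the empty set is $0$; moreover, if $\mathcal M(\mathbf a,\mathbf b)=\emptyset$, then $S(\mathbf a,\mathbf b)=\emptyset$. -/

import Mathlib

open MeasureTheory Filter Topology
open scoped ENNReal NNReal

noncomputable section

namespace SaturatedSystem

/-! ### Bowen's topological entropy of an arbitrary subset -/

section Topological

variable {X : Type*} [MetricSpace X]

/-- The open ball `B_n(x, ε)` of the Bowen metric `d_n(x, y) = max_{0 ≤ j < n} d(T^j x, T^j y)`
(for `n ≥ 1`). -/
def bowenBall (T : X → X) (n : ℕ) (x : X) (ε : ℝ) : Set X :=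
  {y | ∀ j < n, dist (T^[j] x) (T^[j] y) < ε}

/-- An at most countable collection `R` of Bowen balls `B_n(x, ε)`, each encoded by the pair
`(x, n)` with `n ≥ 1`, that covers `Z` and satisfies `n(R) ≥ N`. -/
def IsBowenCover (T : X → X) (Z : Set X) (ε : ℝ) (N : ℕ) (R : Set (X × ℕ)) : Prop :=
  R.Countable ∧ (∀ p ∈ R, 1 ≤ p.2 ∧ N ≤ p.2) ∧ Z ⊆ ⋃ p ∈ R, bowenBall T p.2 p.1 ε

/-- `H^s_N(Z, ε) = inf_R ∑ exp(-s n_i)`. -/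
def bowenPreMeasure (T : X → X) (Z : Set X) (ε : ℝ) (s : ℝ≥0) (N : ℕ) : ℝ≥0∞ :=
  ⨅ (R : Set (X × ℕ)) (_ : IsBowenCover T Z ε N R),
    ∑' p : R, ENNReal.ofReal (Real.exp (-(s : ℝ) * ((p : X × ℕ).2 : ℝ)))

/-- `H^s(Z, ε) = lim_N H^s_N(Z, ε)`; the limit is a supremum, because `H^s_N` is non-decreasing
in `N`. -/
def bowenMeasure (T : X → X) (Z : Set X) (ε : ℝ) (s : ℝ≥0) : ℝ≥0∞ :=
  ⨆ N : ℕ, bowenPreMeasure T Z ε s N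

/-- The critical value `h_top(Z, ε)` of `s ≥ 0`: `H^s(Z, ε)` vanishes for all larger `s` and is
infinite for all smaller `s`. It is `∞` if `H^s(Z, ε)` does not vanish for any `s`. -/
def topEntropyAt (T : X → X) (Z : Set X) (ε : ℝ) : ℝ≥0∞ :=
  ⨅ (s : ℝ≥0) (_ : bowenMeasure T Z ε s = 0), (s : ℝ≥0∞)

/-- Bowen's topological entropy `h_top(Z) = lim_{ε → 0} h_top(Z, ε)`; the limit is a supremum,
because `h_top(Z, ε)` is non-increasing in `ε`. -/
def topEntropy (T : X → X) (Z : Set X) : ℝ≥0∞ :=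
  ⨆ (ε : ℝ) (_ : 0 < ε), topEntropyAt T Z ε

end Topological

/-! ### Invariant measures and measure-theoretic entropy -/

section MeasureTheoretic

variable {X : Type*} [MeasurableSpace X]

/-- The set of `T`-invariant probability measures. -/
def invariantMeasures (T : X → X) : Set (Measure X) :=
  {μ | IsProbabilityMeasure μ ∧ MeasurePreserving T μ μ}

/-- A finite measurable partition is given by its label map `ξ : X → Fin k`. This is the Shannon
entropy of the joined partition `⋁_{i < n} T^{-i} ξ`, whose atoms are indexed by the words `w` of
length `n`. -/
def joinEntropy (T : X → X) (μ : Measure X) {k : ℕ} (ξ : X → Fin k) (n : ℕ) : ℝ :=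
  ∑ w : Fin n → Fin k, Real.negMulLog (μ.real {x | ∀ i : Fin n, ξ (T^[i] x) = w i})

/-- The entropy of `T` with respect to the partition `ξ`: the limit (it exists for invariant `μ`)
of `1/n` times the entropy of `⋁_{i < n} T^{-i} ξ`. -/
def partitionEntropy (T : X → X) (μ : Measure X) {k : ℕ} (ξ : X → Fin k) : ℝ≥0∞ :=
  limsup (fun n : ℕ => ENNReal.ofReal (joinEntropy T μ ξ n / n)) atTop

/-- The Kolmogorov–Sinai entropy `h_μ`: the supremum over all finite measurable partitions. -/
def measureEntropy (T : X → X) (μ : Measure X) : ℝ≥0∞ :=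
  ⨆ (k : ℕ) (ξ : X → Fin k) (_ : Measurable ξ), partitionEntropy T μ ξ

/-- The empirical measure `(1/n) ∑_{j < n} δ_{T^j x}`. -/
def empiricalMeasure (T : X → X) (n : ℕ) (x : X) : Measure X :=
  (n : ℝ≥0∞)⁻¹ • ∑ j ∈ Finset.range n, Measure.dirac (T^[j] x)

end MeasureTheoretic

/-! ### Generic points, saturated systems and the sets of points under study -/

section Saturated

variable {X : Type*} [MetricSpace X] [MeasurableSpace X]

/-- The set `G_μ` of `μ`-generic points: the empirical measures converge weak-star to `μ`. -/
def genericPoints (T : X → X) (μ : Measure X) : Set X :=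
  {x | ∀ f : C(X, ℝ),
    Tendsto (fun n : ℕ => ∫ y, f y ∂(empiricalMeasure T n x)) atTop (𝓝 (∫ y, f y ∂μ))}

/-- The system is saturated: `h_top(G_μ) = h_μ` for each invariant probability measure `μ`. -/
def IsSaturated (T : X → X) : Prop :=
  ∀ μ ∈ invariantMeasures T, topEntropy T (genericPoints T μ) = measureEntropy T μ

/-- The set `S(a, b)` of points `x` with
`a_i ≤ liminf A_n Φ_i(x) ≤ limsup A_n Φ_i(x) ≤ b_i` for all `i`. -/
def averageSet {ι : Type*} (T : X → X) (Φ : ι → C(X, ℝ)) (a b : ι → ℝ) : Set X :=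
  {x | ∀ i, a i ≤ liminf (fun n : ℕ => birkhoffAverage ℝ T (Φ i) n x) atTop ∧
    limsup (fun n : ℕ => birkhoffAverage ℝ T (Φ i) n x) atTop ≤ b i}

/-- The invariant probability measures `μ` with `a_i ≤ ∫ Φ_i dμ ≤ b_i` for all `i`. -/
def measureSet {ι : Type*} (T : X → X) (Φ : ι → C(X, ℝ)) (a b : ι → ℝ) : Set (Measure X) :=
  {μ | μ ∈ invariantMeasures T ∧ ∀ i, a i ≤ ∫ x, Φ i x ∂μ ∧ ∫ x, Φ i x ∂μ ≤ b i}

end Saturated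

end SaturatedSystem

end

namespace SaturatedSystem

/-! ### Bowen's entropy: monotonicity and an upper bound from finite covers -/

section TopologicalBounds

variable {X : Type*} [MetricSpace X] {T : X → X}

/-! Lower bound: generic points of any `μ` in `measureSet` lie in `averageSet`, so saturation and
monotonicity of `topEntropy` suffice; saturation enters only here.

Upper bound: for `x` in `averageSet`, every weak-* limit point of the empirical measures lies in
`measureSet` (`mem_measureSet_of_mapClusterPt`). Near a measure of entropy below `c`, the points
whose `n`-th empirical measure is close to it need only `C exp (n c)` Bowen balls
(`exists_nhds_finset_bowenBall`). Since `measureSet` is weak-* compact, finitely many such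
neighbourhoods serve all of `averageSet`, each point being caught for infinitely many `n`; for `s >
c` the tails of a geometric series give `H^s = 0`.

The local count is a coding argument: a code on `m`-words with Kraft sum at most 1 and mean length
below `m c` under `μ` keeps that mean length for nearby empirical measures, and few orbit words have
short codes.

Limit points exist by compactness, which gives the emptiness claim. -/

lemma bowenPreMeasure_mono {Z Z' : Set X} (h : Z ⊆ Z') (ε : ℝ) (s : ℝ≥0) (N : ℕ) :
    bowenPreMeasure T Z ε s N ≤ bowenPreMeasure T Z' ε s N :=
  le_iInf₂ fun R hR => iInf₂_le R ⟨hR.1, hR.2.1, h.trans hR.2.2⟩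

lemma topEntropy_mono {Z Z' : Set X} (h : Z ⊆ Z') : topEntropy T Z ≤ topEntropy T Z' := by
  refine iSup₂_mono fun ε _ => le_iInf₂ fun s hs => iInf₂_le s ?_
  exact le_antisymm ((iSup_mono fun N => bowenPreMeasure_mono h ε s N).trans hs.le) bot_le

/-- If the points of `Z` are covered infinitely often by families of `≤ C exp (n c)` Bowen balls
of order `n`, then `H^s(Z, ε) = 0` for each `s > c`. -/
lemma bowenMeasure_eq_zero {Z : Set X} {ε C c : ℝ} {s : ℝ≥0} (hcs : c < s) (F : ℕ → Finset X)
    (hF : ∀ n, ((F n).card : ℝ) ≤ C * Real.exp (n * c))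
    (hZ : ∀ x ∈ Z, ∃ᶠ n in atTop, ∃ y ∈ F n, x ∈ bowenBall T n y ε) :
    bowenMeasure T Z ε s = 0 := by
  set ρ : ℝ≥0∞ := ENNReal.ofReal (Real.exp (c - s)) with hρ
  have hρ1 : ρ < 1 := by
    rw [hρ, ENNReal.ofReal_lt_one, Real.exp_lt_one_iff]
    linarith
  have hC : 0 ≤ C := by simpa using (Nat.cast_nonneg _).trans (hF 0)
  refine ENNReal.iSup_eq_zero.2 fun N => ?_
  -- Every point is caught at some order `≥ M`, so the families of orders `≥ M` form an admissible
  -- cover for the fixed `N`; its cost is a geometric tail, and `M → ∞`.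
  have key : ∀ M, max N 1 ≤ M →
      bowenPreMeasure T Z ε s N ≤ ENNReal.ofReal C * ρ ^ M * (1 - ρ)⁻¹ := by
    intro M hM
    set R : ℕ → Set (X × ℕ) := fun n => (F (n + M) ×ˢ {n + M} : Finset (X × ℕ)) with hR
    have hcover : IsBowenCover T Z ε N (⋃ n, R n) := by
      refine ⟨Set.countable_iUnion fun n => Finset.countable_toSet _, ?_, ?_⟩
      · intro p hp
        obtain ⟨n, hn⟩ := Set.mem_iUnion.1 hp
        have hp2 : p.2 = n + M := by
          simp only [hR, Finset.mem_coe, Finset.mem_product, Finset.mem_singleton] at hn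
          exact hn.2
        omega
      · intro x hx
        obtain ⟨n, hn, y, hy, hxy⟩ := (frequently_atTop.1 (hZ x hx)) M
        obtain ⟨j, rfl⟩ := Nat.exists_eq_add_of_le' hn
        exact Set.mem_biUnion (x := (y, j + M)) (Set.mem_iUnion.2 ⟨j, by simpa [hR] using hy⟩) hxy
    calc bowenPreMeasure T Z ε s N
        ≤ ∑' p : (⋃ n, R n : Set (X × ℕ)),
            ENNReal.ofReal (Real.exp (-(s : ℝ) * ((p : X × ℕ).2 : ℝ))) := iInf₂_le _ hcover
      _ ≤ ∑' n, ∑' p : R n, ENNReal.ofReal (Real.exp (-(s : ℝ) * ((p : X × ℕ).2 : ℝ))) :=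
          ENNReal.tsum_iUnion_le_tsum
            (fun p : X × ℕ => ENNReal.ofReal (Real.exp (-(s : ℝ) * (p.2 : ℝ)))) R
      _ ≤ ∑' n, ENNReal.ofReal C * ρ ^ M * ρ ^ n := by
          refine ENNReal.tsum_le_tsum fun n => ?_
          rw [hR, Finset.tsum_subtype' _
            (fun p : X × ℕ => ENNReal.ofReal (Real.exp (-(s : ℝ) * (p.2 : ℝ))))]
          rw [Finset.sum_product]
          simp only [Finset.sum_singleton, Finset.sum_const, nsmul_eq_mul]
          rw [mul_assoc, ← pow_add, hρ, ← ENNReal.ofReal_pow (Real.exp_pos _).le,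
            ← ENNReal.ofReal_mul hC, ← ENNReal.ofReal_natCast,
            ← ENNReal.ofReal_mul (Nat.cast_nonneg _)]
          refine ENNReal.ofReal_le_ofReal ((mul_le_mul_of_nonneg_right (hF _)
            (Real.exp_pos _).le).trans (le_of_eq ?_))
          rw [mul_assoc, ← Real.exp_add, ← Real.exp_nat_mul]
          push_cast
          ring_nf
      _ = ENNReal.ofReal C * ρ ^ M * (1 - ρ)⁻¹ := by
          rw [ENNReal.tsum_mul_left, ENNReal.tsum_geometric]
  have hlim : Tendsto (fun M => ENNReal.ofReal C * ρ ^ M * (1 - ρ)⁻¹) atTop (𝓝 0) := by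
    have h := ENNReal.Tendsto.const_mul (a := ENNReal.ofReal C * (1 - ρ)⁻¹)
      (ENNReal.tendsto_pow_atTop_nhds_zero_of_lt_one hρ1)
      (Or.inr (ENNReal.mul_ne_top ENNReal.ofReal_ne_top
        (ENNReal.inv_ne_top.2 (tsub_pos_of_lt hρ1).ne')))
    rw [mul_zero] at h
    exact h.congr fun M => by ring
  exact le_antisymm (ge_of_tendsto hlim (eventually_atTop.2 ⟨_, key⟩)) bot_le

end TopologicalBounds

/-! ### Counting words -/

section Counting

/-- The word of length `m` read along the orbit of `x` through the labelling `ξ`. -/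
def orbitWord {X E : Type*} (T : X → X) (ξ : X → E) (m : ℕ) (x : X) : Fin m → E :=
  fun i => ξ (T^[i] x)

lemma sum_range_mul_eq (f : ℕ → ℝ) (m N : ℕ) :
    ∑ j ∈ Finset.range (m * N), f j =
      ∑ r ∈ Finset.range m, ∑ i : Fin N, f (m * i + r) := by
  rw [Finset.sum_comm]
  induction N with
  | zero => simp
  | succ N ih => rw [Nat.mul_succ, Finset.sum_range_add, ih, Fin.sum_univ_castSucc]; simp

variable {X E : Type*} {T : X → X} {ξ : X → E}

/-- Positions below `r` are read in the initial word; a position `l ≥ r` lies in block `(l - r) / m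
≤ N` of the tiling that starts at `r`. -/
lemma orbitWord_eq_of_blocks {m N r : ℕ} (hr : r < m) {x y : X}
    (h₀ : orbitWord T ξ m x = orbitWord T ξ m y)
    (h₁ : ∀ i : Fin N, orbitWord T ξ m (T^[m * i + r] x) = orbitWord T ξ m (T^[m * i + r] y))
    (h₂ : orbitWord T ξ m (T^[m * N + r] x) = orbitWord T ξ m (T^[m * N + r] y)) :
    orbitWord T ξ (m * (N + 1)) x = orbitWord T ξ (m * (N + 1)) y := by
  have hblock : ∀ i ≤ N,
      orbitWord T ξ m (T^[m * i + r] x) = orbitWord T ξ m (T^[m * i + r] y) := by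
    intro i hi
    rcases hi.lt_or_eq with hi | rfl
    · exact h₁ ⟨i, hi⟩
    · exact h₂
  funext ⟨l, hl⟩
  simp only [orbitWord]
  by_cases hlr : l < r
  · exact congrFun h₀ ⟨l, hlr.trans hr⟩
  · have hm : 0 < m := by omega
    have hdiv : (l - r) / m ≤ N := by
      rw [← Nat.lt_succ_iff, Nat.div_lt_iff_lt_mul hm, mul_comm]
      exact (Nat.sub_le _ _).trans_lt hl
    have h := congrFun (hblock _ hdiv) ⟨(l - r) % m, Nat.mod_lt _ hm⟩
    have hl' : (l - r) % m + (m * ((l - r) / m) + r) = l := by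
      have := Nat.mod_add_div (l - r) m
      omega
    simpa only [orbitWord, ← Function.iterate_add_apply, hl'] using h

variable [Fintype E]

/-- Kraft's inequality for concatenations: the sum over `N` free blocks factors as a power of the
Kraft sum. The square counts the initial and final words, which carry no weight. -/
lemma sum_exp_blocks_le {m N r : ℕ} (hr : r < m) (ℓ : (Fin m → E) → ℝ)
    (hℓ : ∑ w, Real.exp (-ℓ w) ≤ 1) (F : Finset X)
    (hF : Set.InjOn (orbitWord T ξ (m * (N + 1))) F) :
    ∑ x ∈ F, Real.exp (-∑ i : Fin N, ℓ (orbitWord T ξ m (T^[m * i + r] x))) ≤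
      (Fintype.card (Fin m → E) : ℝ) ^ 2 := by
  classical
  let φ : X → (Fin m → E) × (Fin m → E) × (Fin N → Fin m → E) := fun x =>
    (orbitWord T ξ m x, orbitWord T ξ m (T^[m * N + r] x),
      fun i => orbitWord T ξ m (T^[m * i + r] x))
  let g : (Fin m → E) × (Fin m → E) × (Fin N → Fin m → E) → ℝ := fun p =>
    ∏ i, Real.exp (-ℓ (p.2.2 i))
  have hφ : Set.InjOn φ F := by
    intro x hx y hy hxy
    simp only [φ, Prod.mk.injEq] at hxy
    exact hF hx hy (orbitWord_eq_of_blocks hr hxy.1 (congrFun hxy.2.2) hxy.2.1)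
  have hg : ∀ p, 0 ≤ g p := fun p => Finset.prod_nonneg fun i _ => (Real.exp_pos _).le
  calc ∑ x ∈ F, Real.exp (-∑ i : Fin N, ℓ (orbitWord T ξ m (T^[m * i + r] x)))
      = ∑ x ∈ F, g (φ x) := by
        refine Finset.sum_congr rfl fun x _ => ?_
        simp only [g, φ, ← Real.exp_sum, Finset.sum_neg_distrib]
    _ = ∑ p ∈ F.image φ, g p := (Finset.sum_image hφ).symm
    _ ≤ ∑ p, g p := Finset.sum_le_sum_of_subset_of_nonneg (Finset.subset_univ _)
        fun p _ _ => hg p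
    _ = (Fintype.card (Fin m → E) : ℝ) ^ 2 * (∑ w, Real.exp (-ℓ w)) ^ N := by
        rw [Finset.sum_pow', Fintype.piFinset_univ]
        simp only [g, Fintype.sum_prod_type, Finset.sum_const, Finset.card_univ, nsmul_eq_mul]
        ring
    _ ≤ (Fintype.card (Fin m → E) : ℝ) ^ 2 * 1 := by
        gcongr
        exact pow_le_one₀ (Finset.sum_nonneg fun w _ => (Real.exp_pos _).le) hℓ
    _ = _ := mul_one _

/-- Orbit segments along which the code length `ℓ` of the subwords of length `m` is on average
less than `m c` number at most `C exp (n c)`. -/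
lemma card_le_of_codeLength {m n : ℕ} (hm : 0 < m) {c : ℝ} (ℓ : (Fin m → E) → ℝ)
    (hℓ : ∑ w, Real.exp (-ℓ w) ≤ 1) (F : Finset X)
    (hF : Set.InjOn (orbitWord T ξ (m * (n / m + 1))) F)
    (hc : ∀ x ∈ F, ∑ j ∈ Finset.range n, ℓ (orbitWord T ξ m (T^[j] x)) ≤ n * (m * c)) :
    (F.card : ℝ) ≤ (Fintype.card (Fin m → E) : ℝ) ^ 2 * Real.exp (n * c) := by
  set N := n / m
  have hm' : (0 : ℝ) < m := Nat.cast_pos.2 hm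
  -- Nonnegative lengths allow the terms `m * N ≤ j < n` to be dropped below.
  have hℓ0 : ∀ w, 0 ≤ ℓ w := fun w => by
    have : Real.exp (-ℓ w) ≤ 1 := (Finset.single_le_sum (f := fun w => Real.exp (-ℓ w))
      (fun w _ => (Real.exp_pos _).le) (Finset.mem_univ w)).trans hℓ
    simpa using this
  let y : ℕ → X → ℝ := fun r x => -∑ i : Fin N, ℓ (orbitWord T ξ m (T^[m * i + r] x))
  -- Overlapping `m`-words split into `m` tilings, one per residue `r`; Jensen's inequality for
  -- `exp` passes to the average over `r`.
  have hx : ∀ x ∈ F, Real.exp (-(n * c)) ≤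
      ∑ r ∈ Finset.range m, (m : ℝ)⁻¹ * Real.exp (y r x) := by
    intro x hxF
    have h1 : ∑ r ∈ Finset.range m, -y r x ≤ n * (m * c) := by
      simp only [y, neg_neg]
      rw [← sum_range_mul_eq (fun j => ℓ (orbitWord T ξ m (T^[j] x)))]
      exact (Finset.sum_le_sum_of_subset_of_nonneg
        (Finset.range_mono (Nat.mul_div_le n m)) fun j _ _ => hℓ0 _).trans (hc x hxF)
    have h2 : -(n * c) ≤ ∑ r ∈ Finset.range m, (m : ℝ)⁻¹ • y r x := by
      simp only [smul_eq_mul]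
      rw [← Finset.mul_sum, le_inv_mul_iff₀ hm']
      rw [Finset.sum_neg_distrib] at h1
      linarith
    refine (Real.exp_le_exp.2 h2).trans ?_
    exact convexOn_exp.map_sum_le (fun _ _ => (inv_pos.2 hm').le)
      (by simp [hm'.ne']) (fun _ _ => Set.mem_univ _)
  have hsum : (F.card : ℝ) * Real.exp (-(n * c)) ≤ (Fintype.card (Fin m → E) : ℝ) ^ 2 := by
    calc (F.card : ℝ) * Real.exp (-(n * c)) = ∑ x ∈ F, Real.exp (-(n * c)) := by simp
      _ ≤ ∑ x ∈ F, ∑ r ∈ Finset.range m, (m : ℝ)⁻¹ * Real.exp (y r x) := Finset.sum_le_sum hx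
      _ = ∑ r ∈ Finset.range m, (m : ℝ)⁻¹ * ∑ x ∈ F, Real.exp (y r x) := by
          rw [Finset.sum_comm]; simp only [Finset.mul_sum]
      _ ≤ ∑ r ∈ Finset.range m, (m : ℝ)⁻¹ * (Fintype.card (Fin m → E) : ℝ) ^ 2 := by
          refine Finset.sum_le_sum fun r hr => mul_le_mul_of_nonneg_left ?_ (inv_pos.2 hm').le
          exact sum_exp_blocks_le (Finset.mem_range.1 hr) ℓ hℓ F hF
      _ = _ := by simp [hm'.ne']
  rwa [Real.exp_neg, ← div_eq_mul_inv, div_le_iff₀ (Real.exp_pos _)] at hsum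

/-- A code whose mean length nearly attains the entropy of a probability vector. -/
lemma exists_codeLength {α : Type*} [Fintype α] (p : α → ℝ) (hp : ∀ w, 0 ≤ p w)
    (hp1 : ∑ w, p w = 1) {d : ℝ} (hd : ∑ w, Real.negMulLog (p w) < d) :
    ∃ ℓ : α → ℝ, ∑ w, Real.exp (-ℓ w) ≤ 1 ∧ ∑ w, p w * ℓ w < d := by
  set H := ∑ w, Real.negMulLog (p w)
  set K : ℝ := (Fintype.card α : ℝ)
  have hK : 0 ≤ K := Nat.cast_nonneg _
  -- Smoothing by `η` gives words of probability zero a finite length; the extra mean length is at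
  -- most `η * K < d - H`.
  set η : ℝ := (d - H) / (K + 1) with hη
  have hη0 : 0 < η := div_pos (sub_pos.2 hd) (by positivity)
  have hηK : η * K < d - H := by
    rw [hη, div_mul_eq_mul_div, div_lt_iff₀ (by positivity)]
    nlinarith
  have hden : 0 < 1 + η * K := by positivity
  refine ⟨fun w => -Real.log ((p w + η) / (1 + η * K)), ?_, ?_⟩
  · have hpos : ∀ w, 0 < (p w + η) / (1 + η * K) := fun w =>
      div_pos (add_pos_of_nonneg_of_pos (hp w) hη0) hden
    simp only [neg_neg, Real.exp_log (hpos _)]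
    rw [← Finset.sum_div, Finset.sum_add_distrib, hp1, Finset.sum_const, Finset.card_univ,
      nsmul_eq_mul, mul_comm (Fintype.card α : ℝ), div_self hden.ne']
  · calc ∑ w, p w * -Real.log ((p w + η) / (1 + η * K))
        ≤ ∑ w, (Real.negMulLog (p w) + p w * (η * K)) := by
          refine Finset.sum_le_sum fun w _ => ?_
          rcases (hp w).eq_or_lt with h0 | h0
          · simp [← h0]
          · rw [Real.log_div (by positivity) hden.ne', Real.negMulLog]
            have h1 : Real.log (p w) ≤ Real.log (p w + η) :=
              Real.log_le_log h0 (by linarith)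
            have h2 : Real.log (1 + η * K) ≤ η * K := by
              linarith [Real.log_le_sub_one_of_pos hden]
            nlinarith [mul_nonneg (hp w) (sub_nonneg.2 h1), mul_nonneg (hp w) (sub_nonneg.2 h2)]
      _ = H + η * K := by rw [Finset.sum_add_distrib, ← Finset.sum_mul, hp1, one_mul]
      _ < d := by linarith

end Counting

/-! ### Empirical measures -/

section Empirical

variable {X : Type*} [MeasurableSpace X] (T : X → X)

lemma integral_empiricalMeasure [MeasurableSingletonClass X] (f : X → ℝ) (n : ℕ) (x : X) :
    ∫ y, f y ∂(empiricalMeasure T n x) = birkhoffAverage ℝ T f n x := by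
  rw [empiricalMeasure, integral_smul_measure, integral_finsetSum_measure
    fun j _ => integrable_dirac (by simp)]
  simp [birkhoffAverage, birkhoffSum]

lemma isProbabilityMeasure_empiricalMeasure {n : ℕ} (hn : n ≠ 0) (x : X) :
    IsProbabilityMeasure (empiricalMeasure T n x) := by
  constructor
  simp [empiricalMeasure, ENNReal.inv_mul_cancel, hn]

/-- The empirical measure as a probability measure, with the convention `δ_x` for `n = 0`. -/
noncomputable def empiricalProbability (n : ℕ) (x : X) : ProbabilityMeasure X :=
  if h : n = 0 then ⟨Measure.dirac x, inferInstance⟩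
  else ⟨empiricalMeasure T n x, isProbabilityMeasure_empiricalMeasure T h x⟩

lemma coe_empiricalProbability {n : ℕ} (hn : n ≠ 0) (x : X) :
    (empiricalProbability T n x : Measure X) = empiricalMeasure T n x := by
  simp [empiricalProbability, hn]

end Empirical

/-! ### Partitions with null boundaries -/

section NullBoundary

lemma null_frontier_iInter {X κ : Type*} [TopologicalSpace X] [MeasurableSpace X] {μ : Measure X}
    (s : Finset κ) (A : κ → Set X) (hA : ∀ i ∈ s, μ (frontier (A i)) = 0) :
    μ (frontier (⋂ i ∈ s, A i)) = 0 := by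
  classical
  induction s using Finset.induction_on with
  | empty => simp
  | insert i s _ ih =>
    rw [Finset.set_biInter_insert]
    exact null_frontier_inter (hA i (Finset.mem_insert_self _ _))
      (ih fun j hj => hA j (Finset.mem_insert_of_mem hj))

lemma null_frontier_preimage {X : Type*} [TopologicalSpace X] [MeasurableSpace X]
    [OpensMeasurableSpace X] {μ : Measure X} {T : X → X} (hT : Continuous T)
    (hμ : MeasurePreserving T μ μ) {A : Set X} (hA : μ (frontier A) = 0) :
    μ (frontier (T ⁻¹' A)) = 0 :=
  measure_mono_null (hT.frontier_preimage_subset A)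
    ((hμ.measure_preimage isClosed_frontier.measurableSet.nullMeasurableSet).trans hA)

variable {X : Type*} [MetricSpace X] [MeasurableSpace X] [BorelSpace X]

/-- Balls of suitable radii below `ε / 2` have null frontiers; each point is labelled by the first
ball of a finite subcover containing it. -/
lemma exists_partition_null_frontier [CompactSpace X] (μ : Measure X) [IsProbabilityMeasure μ]
    {ε : ℝ} (hε : 0 < ε) :
    ∃ (k : ℕ) (ξ : X → Fin k), Measurable ξ ∧ (∀ x y, ξ x = ξ y → dist x y < ε) ∧
      ∀ i, μ (frontier (ξ ⁻¹' {i})) = 0 := by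
  have hr : ∀ x : X, ∃ r ∈ Set.Ioo (0 : ℝ) (ε / 2), μ (frontier (Metric.ball x r)) = 0 :=
    fun x => by simpa using exists_null_frontier_thickening μ {x} (half_pos hε)
  choose r hr0 hr1 using hr
  obtain ⟨t, ht⟩ := CompactSpace.elim_nhds_subcover (fun x => Metric.ball x (r x))
    fun x => Metric.ball_mem_nhds x (hr0 x).1
  let z : Fin t.card → X := fun i => t.equivFin.symm i
  let B : Fin t.card → Set X := fun i => Metric.ball (z i) (r (z i))
  have hB : ∀ x, ∃ i, x ∈ B i := by
    intro x
    have hx : x ∈ ⋃ y ∈ t, Metric.ball y (r y) := ht ▸ Set.mem_univ x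
    obtain ⟨y, hy, hxy⟩ := Set.mem_iUnion₂.1 hx
    exact ⟨t.equivFin ⟨y, hy⟩, by simpa [B, z] using hxy⟩
  have hfirst : ∀ x, ∃ i, x ∈ B i ∧ ∀ j < i, x ∉ B j := fun x =>
    ⟨_, WellFounded.min_mem wellFounded_lt {i | x ∈ B i} (hB x), fun j hj hx =>
      WellFounded.not_lt_min wellFounded_lt {i | x ∈ B i} hx hj⟩
  choose ξ hξ hξ' using hfirst
  have hpre : ∀ i, ξ ⁻¹' {i} = B i ∩ ⋂ j ∈ Finset.Iio i, (B j)ᶜ := by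
    intro i
    ext x
    simp only [Set.mem_preimage, Set.mem_singleton_iff, Set.mem_inter_iff, Set.mem_iInter,
      Finset.mem_Iio, Set.mem_compl_iff]
    refine ⟨fun h => h ▸ ⟨hξ x, hξ' x⟩, fun h => ?_⟩
    rcases lt_trichotomy (ξ x) i with hlt | heq | hgt
    · exact absurd (hξ x) (h.2 _ hlt)
    · exact heq
    · exact absurd h.1 (hξ' x _ hgt)
  have hBnull : ∀ i, μ (frontier (B i)) = 0 := fun i => hr1 _
  refine ⟨t.card, ξ, measurable_to_countable' fun i => ?_, fun x y hxy => ?_, fun i => ?_⟩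
  · rw [hpre]
    exact measurableSet_ball.inter
      (Finset.measurableSet_biInter _ fun j _ => measurableSet_ball.compl)
  · have h1 : dist x (z (ξ x)) < r (z (ξ x)) := hξ x
    have h2 : dist y (z (ξ x)) < r (z (ξ x)) := hxy ▸ hξ y
    have h3 := (hr0 (z (ξ x))).2
    linarith [dist_triangle_right x y (z (ξ x))]
  · rw [hpre]
    refine null_frontier_inter (hBnull i) (null_frontier_iInter _ _ fun j _ => ?_)
    rw [frontier_compl]
    exact hBnull j

lemma null_frontier_orbitWord {μ : Measure X} {T : X → X} (hT : Continuous T)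
    (hμ : MeasurePreserving T μ μ) {E : Type*} {ξ : X → E}
    (hξ : ∀ i, μ (frontier (ξ ⁻¹' {i})) = 0) {m : ℕ} (w : Fin m → E) :
    μ (frontier (orbitWord T ξ m ⁻¹' {w})) = 0 := by
  have h : orbitWord T ξ m ⁻¹' {w} =
      ⋂ i ∈ (Finset.univ : Finset (Fin m)), T^[i] ⁻¹' (ξ ⁻¹' {w i}) := by
    ext x
    simp [orbitWord, funext_iff]
  rw [h]
  exact null_frontier_iInter _ _ fun i _ =>
    null_frontier_preimage (hT.iterate i) (hμ.iterate i) (hξ _)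

end NullBoundary

/-! ### Covering the points with empirical measure near an invariant measure -/

lemma exists_separating_finset {X E : Type*} [Finite E] (T : X → X) (ξ : X → E) (Z : Set X) (L : ℕ) :
    ∃ F : Finset X, (∀ x ∈ F, x ∈ Z) ∧ Set.InjOn (orbitWord T ξ L) F ∧
      ∀ x ∈ Z, ∃ y ∈ F, orbitWord T ξ L y = orbitWord T ξ L x := by
  obtain ⟨u, hu, hbij⟩ := (Set.surjOn_image (orbitWord T ξ L) Z).exists_bijOn_subset
  have hfin : u.Finite := Set.Finite.of_finite_image
    (Set.toFinite _) hbij.injOn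
  refine ⟨hfin.toFinset, fun x hx => hu (by simpa using hx), by simpa using hbij.injOn, ?_⟩
  intro x hx
  obtain ⟨y, hy, hxy⟩ := hbij.surjOn (Set.mem_image_of_mem _ hx)
  exact ⟨y, by simpa using hy, hxy⟩

section Covering

variable {X : Type*} [MetricSpace X] [MeasurableSpace X] [BorelSpace X] {T : X → X}

lemma sum_empiricalMeasure_mul {E : Type*} [Fintype E] {ξ : X → E} {m : ℕ}
    (hw : ∀ w, MeasurableSet (orbitWord T ξ m ⁻¹' {w})) (ℓ : (Fin m → E) → ℝ) (n : ℕ) (x : X) :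
    ∑ w, (empiricalMeasure T n x).real (orbitWord T ξ m ⁻¹' {w}) * ℓ w =
      (n : ℝ)⁻¹ * ∑ j ∈ Finset.range n, ℓ (orbitWord T ξ m (T^[j] x)) := by
  classical
  have h : ∀ w, (empiricalMeasure T n x).real (orbitWord T ξ m ⁻¹' {w}) * ℓ w =
      ∑ j ∈ Finset.range n, (n : ℝ)⁻¹ * (if orbitWord T ξ m (T^[j] x) = w then ℓ w else 0) := by
    intro w
    rw [← integral_indicator_one (hw w), integral_empiricalMeasure, birkhoffAverage, birkhoffSum,
      smul_eq_mul, mul_assoc, Finset.sum_mul, Finset.mul_sum]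
    refine Finset.sum_congr rfl fun j _ => ?_
    by_cases h : orbitWord T ξ m (T^[j] x) = w <;> simp [Set.indicator, h]
  simp only [h]
  rw [Finset.sum_comm, Finset.mul_sum]
  refine Finset.sum_congr rfl fun j _ => ?_
  rw [← Finset.mul_sum]
  simp

lemma exists_joinEntropy_lt {X : Type*} [MeasurableSpace X] {T : X → X} {μ : Measure X} {c : ℝ} (hc : measureEntropy T μ < ENNReal.ofReal c)
    {k : ℕ} {ξ : X → Fin k} (hξ : Measurable ξ) :
    ∃ m : ℕ, 0 < m ∧ joinEntropy T μ ξ m < m * c := by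
  have h : partitionEntropy T μ ξ < ENNReal.ofReal c :=
    (le_iSup_of_le (f := fun k => ⨆ (ξ : X → Fin k) (_ : Measurable ξ), partitionEntropy T μ ξ) k
      (le_iSup₂_of_le (f := fun ξ _ => partitionEntropy T μ ξ) ξ hξ le_rfl)).trans_lt hc
  obtain ⟨m, hm, hm0⟩ := ((eventually_lt_of_limsup_lt h).and (eventually_gt_atTop 0)).exists
  refine ⟨m, hm0, ?_⟩
  have := (ENNReal.ofReal_lt_ofReal_iff'.1 hm).1
  rwa [div_lt_iff₀ (Nat.cast_pos.2 hm0), mul_comm] at this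

/-- If `h_μ < c`, then the points whose empirical measure of order `n` is close to `μ` are covered
by at most `C exp (n c)` Bowen balls of order `n`. -/
lemma exists_nhds_finset_bowenBall [CompactSpace X] (hT : Continuous T)
    (μ : ProbabilityMeasure X) (hμ : MeasurePreserving T (μ : Measure X) μ) {c : ℝ}
    (hc : measureEntropy T (μ : Measure X) < ENNReal.ofReal c) {ε : ℝ} (hε : 0 < ε) :
    ∃ W ∈ 𝓝 μ, ∃ C : ℝ, ∀ n : ℕ, ∃ F : Finset X, (F.card : ℝ) ≤ C * Real.exp (n * c) ∧
      ∀ x, n ≠ 0 → empiricalProbability T n x ∈ W → ∃ y ∈ F, x ∈ bowenBall T n y ε := by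
  obtain ⟨k, ξ, hξ, hdiam, hnull⟩ := exists_partition_null_frontier (μ : Measure X) hε
  obtain ⟨m, hm, hH⟩ := exists_joinEntropy_lt hc hξ
  have hmeas : Measurable (orbitWord T ξ m) :=
    measurable_pi_lambda _ fun i => hξ.comp (hT.iterate i).measurable
  have hw : ∀ w, MeasurableSet (orbitWord T ξ m ⁻¹' {w}) := fun w =>
    hmeas (measurableSet_singleton w)
  have hset : ∀ w, orbitWord T ξ m ⁻¹' {w} = {x | ∀ i : Fin m, ξ (T^[i] x) = w i} := by
    intro w
    ext x
    simp [orbitWord, funext_iff]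
  obtain ⟨ℓ, hℓ, hℓμ⟩ := exists_codeLength
    (fun w => (μ : Measure X).real (orbitWord T ξ m ⁻¹' {w})) (fun w => measureReal_nonneg)
    (by
      rw [sum_measureReal_preimage_singleton _ fun w _ => hw w]
      simp)
    (d := m * c) (by simpa only [joinEntropy, hset] using hH)
  refine ⟨{ν | ∑ w, (ν : Measure X).real (orbitWord T ξ m ⁻¹' {w}) * ℓ w < m * c}, ?_,
    (Fintype.card (Fin m → Fin k) : ℝ) ^ 2, fun n => ?_⟩
  -- Cylinders have `μ`-null frontiers, so by the portmanteau theorem their masses are weak-*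
  -- continuous at `μ`.
  · refine Tendsto.eventually_lt_const hℓμ
      (tendsto_finsetSum _ fun w _ => Tendsto.mul_const _ ?_)
    exact (ENNReal.tendsto_toReal (measure_ne_top _ _)).comp
      (ProbabilityMeasure.tendsto_measure_of_null_frontier_of_tendsto' tendsto_id
        (null_frontier_orbitWord hT hμ hnull w))
  · obtain ⟨F, hFZ, hFinj, hF⟩ := exists_separating_finset T ξ
      {x | ∑ j ∈ Finset.range n, ℓ (orbitWord T ξ m (T^[j] x)) ≤ n * (m * c)} (m * (n / m + 1))
    refine ⟨F, card_le_of_codeLength hm ℓ hℓ F hFinj hFZ, fun x hn hx => ?_⟩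
    rw [Set.mem_ofPred_eq, coe_empiricalProbability T hn, sum_empiricalMeasure_mul hw,
      inv_mul_lt_iff₀ (Nat.cast_pos.2 (Nat.pos_of_ne_zero hn))] at hx
    obtain ⟨y, hy, hyx⟩ := hF x hx.le
    -- The common word has length `m * (n / m + 1) > n`, and cells have diameter at most `ε` with
    -- strict inequality between points.
    refine ⟨y, hy, fun j hj => hdiam _ _ ?_⟩
    exact congrFun hyx ⟨j, hj.trans (Nat.lt_mul_div_succ n hm)⟩

end Covering

/-! ### Limit points of the empirical measures -/

section LimitPoints

lemma abs_birkhoffAverage_le {X : Type*} {T : X → X} {g : X → ℝ} {C : ℝ} (hC : 0 ≤ C) (hg : ∀ x, |g x| ≤ C) (n : ℕ)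
    (x : X) : |birkhoffAverage ℝ T g n x| ≤ C := by
  rw [birkhoffAverage, birkhoffSum, smul_eq_mul, abs_mul, abs_inv, Nat.abs_cast]
  refine inv_mul_le_of_le_mul₀ (Nat.cast_nonneg _) hC ?_
  refine (Finset.abs_sum_le_sum_abs _ _).trans ((Finset.sum_le_sum fun j _ => hg _).trans ?_)
  simp

variable {X : Type*} [MetricSpace X] [CompactSpace X] [MeasurableSpace X] [BorelSpace X]
  {T : X → X}

lemma continuous_integral_sub (hT : Continuous T) (f : C(X, ℝ)) :
    Continuous fun μ : ProbabilityMeasure X => ∫ x, f (T x) ∂(μ : Measure X) - ∫ x, f x ∂μ :=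
  (ProbabilityMeasure.continuous_integral_continuousMap (f.comp ⟨T, hT⟩)).sub
    (ProbabilityMeasure.continuous_integral_continuousMap f)

/-- On compact `X` this form exhibits invariance as a weak-* closed condition. -/
lemma measurePreserving_iff_integral {X : Type*} [MetricSpace X] [MeasurableSpace X]
    [BorelSpace X] {T : X → X} (hT : Continuous T) (μ : ProbabilityMeasure X) :
    MeasurePreserving T (μ : Measure X) μ ↔
      ∀ f : C(X, ℝ), ∫ x, f (T x) ∂(μ : Measure X) - ∫ x, f x ∂μ = 0 := by
  have hmap : ∀ f : C(X, ℝ), ∫ x, f x ∂((μ : Measure X).map T) = ∫ x, f (T x) ∂(μ : Measure X) :=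
    fun f => integral_map hT.aemeasurable f.continuous.aestronglyMeasurable
  refine ⟨fun h f => ?_, fun h => ⟨hT.measurable, ?_⟩⟩
  · rw [← hmap, h.map_eq, sub_self]
  · have := Measure.isProbabilityMeasure_map (μ := (μ : Measure X)) hT.aemeasurable
    refine ext_of_forall_integral_eq_of_IsFiniteMeasure fun f => ?_
    exact (hmap f.toContinuousMap).trans (sub_eq_zero.1 (h f.toContinuousMap))

variable {ι : Type*} {Φ : ι → C(X, ℝ)} {a b : ι → ℝ}

lemma isClosed_measureSet (hT : Continuous T) :
    IsClosed {μ : ProbabilityMeasure X | (μ : Measure X) ∈ measureSet T Φ a b} := by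
  have h : {μ : ProbabilityMeasure X | (μ : Measure X) ∈ measureSet T Φ a b} =
      (⋂ f : C(X, ℝ), {μ : ProbabilityMeasure X |
        ∫ x, f (T x) ∂(μ : Measure X) - ∫ x, f x ∂μ = 0}) ∩
      ⋂ i, {μ : ProbabilityMeasure X | ∫ x, Φ i x ∂(μ : Measure X) ∈ Set.Icc (a i) (b i)} := by
    ext μ
    simp only [measureSet, invariantMeasures, Set.mem_ofPred_eq, measurePreserving_iff_integral hT,
      Set.mem_inter_iff, Set.mem_iInter, Set.mem_Icc]
    exact and_congr_left fun _ => and_iff_right inferInstance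
  rw [h]
  exact (isClosed_iInter fun f => isClosed_eq (continuous_integral_sub hT f) continuous_const).inter
    (isClosed_iInter fun i => isClosed_Icc.preimage
      (ProbabilityMeasure.continuous_integral_continuousMap (Φ i)))

lemma mapClusterPt_birkhoffAverage {x : X} {μ : ProbabilityMeasure X}
    (h : MapClusterPt μ atTop fun n => empiricalProbability T n x) (g : C(X, ℝ)) :
    MapClusterPt (∫ y, g y ∂(μ : Measure X)) atTop fun n => birkhoffAverage ℝ T g n x := by
  rw [mapClusterPt_iff_frequently]
  intro s hs
  refine ((h.frequently ((ProbabilityMeasure.continuous_integral_continuousMap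
    g).continuousAt.eventually_mem hs)).and_eventually (eventually_ne_atTop 0)).mono ?_
  rintro n ⟨hn, hn0⟩
  rwa [coe_empiricalProbability T hn0, integral_empiricalMeasure] at hn

/-- Invariance: the averages of `f ∘ T - f` telescope to `0`. Bounds: a limit point of the Birkhoff
averages lies between their liminf and limsup. -/
lemma mem_measureSet_of_mapClusterPt (hT : Continuous T) {x : X} (hx : x ∈ averageSet T Φ a b)
    {μ : ProbabilityMeasure X}
    (h : MapClusterPt μ atTop fun n => empiricalProbability T n x) :
    (μ : Measure X) ∈ measureSet T Φ a b := by
  refine ⟨⟨inferInstance, (measurePreserving_iff_integral hT μ).2 fun f => ?_⟩, fun i => ?_⟩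
  · set g : C(X, ℝ) := f.comp ⟨T, hT⟩ - f
    have h1 : MapClusterPt (∫ y, g y ∂(μ : Measure X)) atTop
        fun n => birkhoffAverage ℝ T f n (T x) - birkhoffAverage ℝ T f n x := by
      have hg : ∀ n, birkhoffAverage ℝ T g n x =
          birkhoffAverage ℝ T f n (T x) - birkhoffAverage ℝ T f n x := fun n => by
        simp only [birkhoffAverage, birkhoffSum, g, ← smul_sub, ← Finset.sum_sub_distrib,
          ContinuousMap.sub_apply, ContinuousMap.comp_apply, ContinuousMap.coe_mk,
          ← Function.iterate_succ_apply, ← Function.iterate_succ_apply']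
      simpa only [hg] using mapClusterPt_birkhoffAverage h g
    have h2 : Tendsto (fun n => birkhoffAverage ℝ T f n (T x) - birkhoffAverage ℝ T f n x) atTop
        (𝓝 0) := tendsto_birkhoffAverage_apply_sub_birkhoffAverage' ℝ
          (isCompact_range f.continuous).isBounded T x
    have h3 : ∫ y, g y ∂(μ : Measure X) = 0 := by
      have : NeBot (𝓝 (∫ y, g y ∂(μ : Measure X)) ⊓ 𝓝 0) := h1.clusterPt.mono h2
      exact eq_of_nhds_neBot this
    have hint : ∀ f : C(X, ℝ), Integrable f (μ : Measure X) := fun f =>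
      f.continuous.integrable_of_hasCompactSupport (HasCompactSupport.of_compactSpace f)
    exact (integral_sub (hint (f.comp ⟨T, hT⟩)) (hint f)).symm.trans h3
  · have hbd : ∀ n, |birkhoffAverage ℝ T (Φ i) n x| ≤ ‖Φ i‖ := fun n =>
      abs_birkhoffAverage_le (norm_nonneg _) (fun y => (Φ i).norm_coe_le_norm y) n x
    have hle : IsBoundedUnder (· ≤ ·) atTop fun n => birkhoffAverage ℝ T (Φ i) n x :=
      isBoundedUnder_of ⟨_, fun n => (abs_le.1 (hbd n)).2⟩
    have hge : IsBoundedUnder (· ≥ ·) atTop fun n => birkhoffAverage ℝ T (Φ i) n x :=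
      isBoundedUnder_of ⟨_, fun n => (abs_le.1 (hbd n)).1⟩
    have hi := mapClusterPt_birkhoffAverage h (Φ i)
    exact ⟨(hx i).1.trans (hi.liminf_le hge),
      (hi.le_limsup hle).trans (hx i).2⟩

lemma exists_mapClusterPt_empiricalProbability (T : X → X) (x : X) :
    ∃ μ : ProbabilityMeasure X, MapClusterPt μ atTop fun n => empiricalProbability T n x :=
  exists_clusterPt_of_compactSpace _

lemma genericPoints_subset_averageSet {μ : Measure X} (hμ : μ ∈ measureSet T Φ a b) :
    genericPoints T μ ⊆ averageSet T Φ a b := by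
  intro x hx i
  have h : Tendsto (fun n => birkhoffAverage ℝ T (Φ i) n x) atTop (𝓝 (∫ y, Φ i y ∂μ)) := by
    simpa only [integral_empiricalMeasure] using hx (Φ i)
  rw [h.liminf_eq, h.limsup_eq]
  exact hμ.2 i

/-- Bowen's upper bound for the entropy of the set of points whose empirical measures
accumulate only on measures of entropy less than `c`. -/
lemma bowenMeasure_averageSet_eq_zero (hT : Continuous T) {c : ℝ} {s : ℝ≥0} (hcs : c < s)
    (hc : ∀ μ ∈ measureSet T Φ a b, measureEntropy T μ < ENNReal.ofReal c) {ε : ℝ} (hε : 0 < ε) :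
    bowenMeasure T (averageSet T Φ a b) ε s = 0 := by
  classical
  have hloc : ∀ μ : ProbabilityMeasure X, ∃ W ∈ 𝓝 μ, (μ : Measure X) ∈ measureSet T Φ a b →
      ∃ (C : ℝ) (F : ℕ → Finset X), ∀ n : ℕ, ((F n).card : ℝ) ≤ C * Real.exp (n * c) ∧
        ∀ x, n ≠ 0 → empiricalProbability T n x ∈ W → ∃ y ∈ F n, x ∈ bowenBall T n y ε := by
    intro μ
    by_cases hμ : (μ : Measure X) ∈ measureSet T Φ a b
    · obtain ⟨W, hW, C, hF⟩ := exists_nhds_finset_bowenBall hT μ hμ.1.2 (hc _ hμ) hε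
      choose F hF using hF
      exact ⟨W, hW, fun _ => ⟨C, F, hF⟩⟩
    -- A dummy neighbourhood: the finite subcover is centred in `measureSet` only.
    · exact ⟨Set.univ, univ_mem, fun h => absurd h hμ⟩
  choose W hW hWF using hloc
  choose! C F hF using hWF
  obtain ⟨t, htM, ht⟩ := (isClosed_measureSet (Φ := Φ) (a := a) (b := b)
    hT).isCompact.elim_nhds_subcover (fun μ => interior (W μ))
      fun μ _ => interior_mem_nhds.2 (hW μ)
  refine bowenMeasure_eq_zero hcs (C := ∑ μ ∈ t, C μ) (fun n => t.biUnion fun μ => F μ n)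
    (fun n => ?_) fun x hx => ?_
  · rw [Finset.sum_mul]
    refine (Nat.cast_le.2 Finset.card_biUnion_le).trans ?_
    push_cast
    exact Finset.sum_le_sum fun μ hμ => (hF μ (htM μ hμ) n).1
  · obtain ⟨μ, hμ⟩ := exists_mapClusterPt_empiricalProbability T x
    obtain ⟨ν, hν, hμν⟩ := Set.mem_iUnion₂.1 (ht (mem_measureSet_of_mapClusterPt hT hx hμ))
    refine ((hμ.frequently (mem_interior_iff_mem_nhds.1 hμν)).and_eventually
      (eventually_ne_atTop 0)).mono fun n hn => ?_
    obtain ⟨y, hy, hxy⟩ := (hF ν (htM ν hν) n).2 x hn.2 hn.1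
    exact ⟨y, Finset.mem_biUnion.2 ⟨ν, hν, hy⟩, hxy⟩

end LimitPoints

end SaturatedSystem

theorem mainTheorem6 {X : Type*} [MetricSpace X] [CompactSpace X] [MeasurableSpace X]
    [BorelSpace X] (T : X → X) (hT : Continuous T) (hsat : SaturatedSystem.IsSaturated T)
    {ι : Type*} [Countable ι] (Φ : ι → C(X, ℝ)) (hΦ : ∃ C : ℝ, ∀ i x, |Φ i x| ≤ C)
    (a b : ι → ℝ) :
    SaturatedSystem.topEntropy T (SaturatedSystem.averageSet T Φ a b) =
        (⨆ μ ∈ SaturatedSystem.measureSet T Φ a b, SaturatedSystem.measureEntropy T μ) ∧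
      (SaturatedSystem.measureSet T Φ a b = ∅ → SaturatedSystem.averageSet T Φ a b = ∅) := by
  refine ⟨le_antisymm ?_ (iSup₂_le fun μ hμ => ?_), fun hM => ?_⟩
  · refine le_of_forall_gt_imp_ge_of_dense fun u hu => ?_
    -- Two numbers are inserted, `sup h_μ < c < s < u`: `c` bounds the entropies, and the gap `s -
    -- c` gives the geometric decay.
    obtain ⟨s, hs, hsu⟩ := ENNReal.lt_iff_exists_nnreal_btwn.1 hu
    obtain ⟨c, hc, hcs⟩ := ENNReal.lt_iff_exists_nnreal_btwn.1 hs
    refine iSup₂_le fun ε hε => (iInf₂_le s ?_).trans hsu.le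
    refine SaturatedSystem.bowenMeasure_averageSet_eq_zero hT (c := c)
      (by exact_mod_cast hcs) (fun μ hμ => ?_) hε
    rw [ENNReal.ofReal_coe_nnreal]
    exact (le_iSup₂ (f := fun μ _ => SaturatedSystem.measureEntropy T μ) μ hμ).trans_lt hc
  · rw [← hsat μ hμ.1]
    exact SaturatedSystem.topEntropy_mono (SaturatedSystem.genericPoints_subset_averageSet hμ)
  · refine Set.eq_empty_of_forall_notMem fun x hx => ?_
    obtain ⟨μ, hμ⟩ := SaturatedSystem.exists_mapClusterPt_empiricalProbability T x
    exact (hM ▸ SaturatedSystem.mem_measureSet_of_mapClusterPt hT hx hμ :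
      (μ : Measure X) ∈ (∅ : Set (Measure X)))
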